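/- Let $Q=(Q,\le,\odot)$ be a commutative semicartesian quantale: a complete lattice with a commutative associative operation $\odot$ satisfying $a\odot\bigvee_i b_i=\bigvee_i(a\odot b_i)$ and $a\odot b\le a,\ a\odot b\le b$ for all $a,b,b_i\in Q$. (If $Q$ has a unit, the unit is the top element; a unit is not needed below.) Regard $Q$ as a poset category. A presheaf $F:Q^{op}\to \mathrm{Set}$ is a sheaf if for every family $(u_i)_{i\in I}$ in $Q$ and all $s_i\in F(u_i)$ with $s_i|_{u_i\odot u_j}=s_j|_{u_i\odot u_j}$ for all $i,j\in I$, there is a unique $s\in F(\bigvee_i u_i)$ with $s|_{u_i}=s_i$ for all $i$. Let $Sh(Q)$ be the full subcategory of sheaves in $PSh(Q)$, and let $\mathbf a$ be the left adjoint of the inclusion $Sh(Q)\hookrightarrow PSh(Q)$ (it exists). The representable presheaves $Q(-,a)$ are sheaves. For sheaves $F,G$ put $F\otimes G:=\mathbf a(F\otimes_{Day}G)$, where $F\otimes_{Day}G$ is the left Kan extension of $(u,v)\mapsto F(u)\times G(v)$ along $\odot:Q^{op}\times Q^{op}\to Q^{op}$. There are projections $F\otimes G\to F$ and $F\otimes G\to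 G$, induced by $(x,y)\mapsto x|_{u\odot v}$ and $(x,y)\mapsto y|_{u\odot v}$ for $(x,y)\in F(u)\times G(v)$. For a sheaf $F$ and subobjects $\phi_i:F_i\rightarrowtail F$ ($i=0,1$), let $F_0\otimes_F F_1\to F_0\otimes F_1$ be the equalizer of the two composites $F_0\otimes F_1\to F_i\xrightarrow{\phi_i}F$, and let $\phi_0*\phi_1\in Sub(F)$ be the least subobject of $F$ through which the resulting morphism $F_0\otimes_F F_1\to F$ factors. Then: 1. For every $a\in Q$, the poset $Sub(Q(-,a))$ of subobjects of $Q(-,a)$ in $Sh(Q)$, with the operation $*$, is a commutative semicartesian quantale; so is $[0,a]=\{q\in Q: q\le a\}$ with $\odot$; and the map $k_a:[0,a]\to Sub(Q(-,a))$, $q\mapsto[Q(-,q)\rightarrowtail Q(-,a)]$, is an isomorphism of quantales, i.e. an isomorphism of posets with $k_a(q\odot r)=k_a(q)*k_a(r)$. 2. If $\mathbf 1$ is the terminal sheaf, $(Sub(\mathbf 1),*)$ is a commutative semicartesian quantale and $Q\to Sub(\mathbf 1)$, $q\mapsto[Q(-,q)\rightarrowtail\mathbf 1]$, is an isomorphism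 of quantales. 3. If $Q$ is not a locale, i.e. $\odot\neq\wedge$, then $Sh(Q)$ is not an elementary topos (a cartesian closed category with pullbacks, a terminal object and a subobject classifier). In particular, this is so if the lattice $(Q,\le)$ has no underlying localic structure, i.e. if binary meets in $Q$ do not distribute over arbitrary joins. -/

import Mathlib

open CategoryTheory CategoryTheory.Limits Opposite
open scoped MonoidalCategory CategoryTheory.MonoidalCategory.ExternalProduct

universe u

/-- A multiplication on an ordered set is semicartesian when `a * b ≤ a` and `a * b ≤ b`. -/
class IsSemicartesian (Q : Type u) [Mul Q] [LE Q] : Prop where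
  mul_le_fst : ∀ a b : Q, a * b ≤ a
  mul_le_snd : ∀ a b : Q, a * b ≤ b

/-- The binary operation `m` makes the poset `P` a commutative semicartesian quantale. -/
structure IsCommSemicartesianQuantale {P : Type*} [PartialOrder P] (m : P → P → P) : Prop where
  exists_isLUB : ∀ S : Set P, ∃ x, IsLUB S x
  exists_isGLB : ∀ S : Set P, ∃ x, IsGLB S x
  assoc : ∀ x y z, m (m x y) z = m x (m y z)
  mul_isLUB : ∀ (x : P) (S : Set P) (s : P), IsLUB S s → IsLUB (m x '' S) (m x s)
  isLUB_mul : ∀ (x : P) (S : Set P) (s : P), IsLUB S s → IsLUB ((fun y => m y x) '' S) (m s x)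
  comm : ∀ x y, m x y = m y x
  le_fst : ∀ x y, m x y ≤ x
  le_snd : ∀ x y, m x y ≤ y

/-- `f` is an isomorphism of posets that carries the operation `m` to the operation `n`. -/
structure IsQuantaleIso {P R : Type*} [PartialOrder P] [PartialOrder R]
    (m : P → P → P) (n : R → R → R) (f : P → R) : Prop where
  bijective : Function.Bijective f
  le_iff_le : ∀ x y, f x ≤ f y ↔ x ≤ y
  map_mul : ∀ x y, f (m x y) = n (f x) (f y)

/-- An elementary topos: a cartesian closed category with pullbacks, a terminal object and a
subobject classifier. -/
def IsElementaryTopos (C : Type*) [Category C] : Prop :=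
  HasPullbacks C ∧ HasTerminal C ∧ HasSubobjectClassifier C ∧
    ∃ _ : CartesianMonoidalCategory C, Nonempty (MonoidalClosed C)

set_option linter.unusedSectionVars false

namespace QuantaleSheaf

section Presheaf

variable {Q : Type u} [Preorder Q]

/-- The restriction of a section along `w ≤ v`. -/
def res (F : Qᵒᵖ ⥤ Type u) {v w : Q} (h : w ≤ v) (s : F.obj (op v)) : F.obj (op w) :=
  F.map (homOfLE h).op s

lemma res_self (F : Qᵒᵖ ⥤ Type u) {v : Q} (h : v ≤ v) (s : F.obj (op v)) : res F h s = s := by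
  simp [res]

lemma res_res (F : Qᵒᵖ ⥤ Type u) {v w x : Q} (h : w ≤ v) (h' : x ≤ w) (s : F.obj (op v)) :
    res F h' (res F h s) = res F (h'.trans h) s := by
  have : (homOfLE (h'.trans h)).op = (homOfLE h).op ≫ (homOfLE h').op := rfl
  simp [res, this]

lemma res_naturality {F G : Qᵒᵖ ⥤ Type u} (f : F ⟶ G) {v w : Q} (h : w ≤ v)
    (s : F.obj (op v)) : f.app (op w) (res F h s) = res G h (f.app (op v) s) :=
  NatTrans.naturality_apply f (homOfLE h).op s

instance (a : Q) (c : Qᵒᵖ) : Subsingleton ((yoneda.obj a).obj c) :=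
  inferInstanceAs (Subsingleton (unop c ⟶ a))

end Presheaf

section Sheaf

variable {Q : Type u} [CommSemigroup Q] [CompleteLattice Q] [IsSemicartesian Q]

/-- A family of sections `s i ∈ F (U i)` is compatible when `s i` and `s j` agree on
`U i * U j`. -/
def Compatible (F : Qᵒᵖ ⥤ Type u) {I : Type u} (U : I → Q) (s : ∀ i, F.obj (op (U i))) : Prop :=
  ∀ i j, res F (IsSemicartesian.mul_le_fst (U i) (U j)) (s i) =
    res F (IsSemicartesian.mul_le_snd (U i) (U j)) (s j)

variable (Q) in
/-- A presheaf is a sheaf when every compatible family over a cover `⨆ i, U i` has a unique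
gluing. -/
def IsSheaf : ObjectProperty (Qᵒᵖ ⥤ Type u) := fun F =>
  ∀ (I : Type u) (U : I → Q) (s : ∀ i, F.obj (op (U i))), Compatible F U s →
    ∃! t : F.obj (op (⨆ i, U i)), ∀ i, res F (le_iSup U i) t = s i

variable (Q) in
/-- The category `Sh(Q)` of sheaves on `Q`, a full subcategory of the presheaves. -/
abbrev Sh : Type (u + 1) := (IsSheaf Q).FullSubcategory

lemma isSheaf_yoneda (a : Q) : IsSheaf Q (yoneda.obj a) := by
  intro I U s _
  have h : ⨆ i, U i ≤ a := iSup_le fun i => leOfHom (s i)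
  exact ⟨homOfLE h, fun i => Subsingleton.elim _ _, fun _ _ => Subsingleton.elim _ _⟩

/-- The representable sheaf `Q(-, a)`. -/
abbrev reprSheaf (a : Q) : Sh Q := ⟨yoneda.obj a, isSheaf_yoneda a⟩

/-- The morphism `Q(-, b) ⟶ Q(-, a)` for `b ≤ a`. -/
def reprMap {b a : Q} (h : b ≤ a) : reprSheaf b ⟶ reprSheaf a :=
  ObjectProperty.homMk (yoneda.map (homOfLE h))

instance (b : Q) {F : Sh Q} (f : reprSheaf b ⟶ F) : Mono f where
  right_cancellation g h _ := by
    ext v x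
    exact Subsingleton.elim (α := (yoneda.obj b).obj v) _ _

end Sheaf

/-! ### Sheafification -/

section Sheafification

variable {Q : Type u} [CommSemigroup Q] [CompleteLattice Q] [IsSemicartesian Q]

/-- The coequalizer of `∐ Q(-, U i * U j) ⇉ ∐ Q(-, U i)`. -/
def sieve {I : Type u} (U : I → Q) : Qᵒᵖ ⥤ Type u where
  obj c := Quot fun i j : {i : I // unop c ≤ U i} => unop c ≤ U i * U j
  map f := ↾(Quot.map (fun i => ⟨i.1, (leOfHom f.unop).trans i.2⟩)
    fun _ _ h => (leOfHom f.unop).trans h)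
  map_id c := by
    ext x
    obtain ⟨i, rfl⟩ := Quot.exists_rep x
    rfl
  map_comp f g := by
    ext x
    obtain ⟨i, rfl⟩ := Quot.exists_rep x
    rfl

/-- The element of the sieve at `c` given by a member of the cover above `c`. -/
def sieveMk {I : Type u} (U : I → Q) {c : Q} (i : I) (h : c ≤ U i) : (sieve U).obj (op c) :=
  Quot.mk _ ⟨i, h⟩

lemma res_sieveMk {I : Type u} (U : I → Q) {c d : Q} (i : I) (h : c ≤ U i) (hd : d ≤ c) :
    res (sieve U) hd (sieveMk U i h) = sieveMk U i (hd.trans h) := rfl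

/-- The morphism from the sieve to the representable presheaf of the supremum. -/
def sieveMap {I : Type u} (U : I → Q) : sieve U ⟶ yoneda.obj (⨆ i, U i) where
  app c := ↾(Quot.lift (fun i => homOfLE (i.2.trans (le_iSup U i.1)))
    fun _ _ _ => Subsingleton.elim _ _)
  naturality _ _ _ := by
    ext x
    exact Subsingleton.elim (α := (yoneda.obj (⨆ i, U i)).obj _) _ _

variable (F : Qᵒᵖ ⥤ Type u) {I : Type u} (U : I → Q)

/-- The morphism out of the sieve given by a compatible family. -/
def sieveDesc (s : ∀ i, F.obj (op (U i))) (hs : Compatible F U s) : sieve U ⟶ F where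
  app c := ↾(Quot.lift (fun i => res F i.2 (s i.1)) fun i j h => by
    have := congrArg (res F h) (hs i.1 j.1)
    rwa [res_res, res_res] at this)
  naturality c d f := by
    ext x
    obtain ⟨i, rfl⟩ := Quot.exists_rep x
    exact (res_res F i.2 (leOfHom f.unop) (s i.1)).symm

/-- The family of sections given by a morphism out of the sieve. -/
def sieveFamily (f : sieve U ⟶ F) (i : I) : F.obj (op (U i)) :=
  f.app (op (U i)) (sieveMk U i le_rfl)

lemma sieveFamily_compatible (f : sieve U ⟶ F) : Compatible F U (sieveFamily F U f) := by
  intro i j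
  rw [sieveFamily, sieveFamily, ← res_naturality, ← res_naturality, res_sieveMk, res_sieveMk]
  exact congrArg (f.app (op (U i * U j))) (Quot.sound le_rfl)

lemma sieveFamily_desc (s : ∀ i, F.obj (op (U i))) (hs : Compatible F U s) :
    sieveFamily F U (sieveDesc F U s hs) = s := by
  funext i
  exact res_self F le_rfl (s i)

lemma sieve_hom_ext {f g : sieve U ⟶ F} (h : sieveFamily F U f = sieveFamily F U g) : f = g := by
  ext c x
  obtain ⟨i, rfl⟩ := Quot.exists_rep x
  have := congrArg (res F i.2) (congrFun h i.1)
  rw [sieveFamily, sieveFamily, ← res_naturality, ← res_naturality] at this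
  exact this

lemma sieveFamily_comp (g : yoneda.obj (⨆ i, U i) ⟶ F) (i : I) :
    sieveFamily F U (sieveMap U ≫ g) i = res F (le_iSup U i) (yonedaEquiv g) := by
  have := res_naturality g (le_iSup U i) (𝟙 (⨆ i, U i))
  rw [yonedaEquiv_apply, ← this]
  exact congrArg (g.app (op (U i)))
    (Subsingleton.elim (α := (yoneda.obj (⨆ i, U i)).obj (op (U i))) _ _)

lemma bijective_sieveMap_iff :
    Function.Bijective (fun g : yoneda.obj (⨆ i, U i) ⟶ F => sieveMap U ≫ g) ↔
      ∀ s : ∀ i, F.obj (op (U i)), Compatible F U s →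
        ∃! t : F.obj (op (⨆ i, U i)), ∀ i, res F (le_iSup U i) t = s i := by
  constructor
  · intro h s hs
    obtain ⟨g, hg⟩ := h.2 (sieveDesc F U s hs)
    refine ⟨yonedaEquiv g, fun i => ?_, fun t ht => ?_⟩
    · rw [← sieveFamily_comp]
      dsimp only at hg
      rw [hg, sieveFamily_desc]
    · obtain ⟨g', rfl⟩ := yonedaEquiv.surjective t
      congr 1
      refine h.1 (Eq.trans (sieve_hom_ext F U ?_) hg.symm)
      rw [sieveFamily_desc]
      funext i
      rw [sieveFamily_comp, ht]
  · intro h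
    constructor
    · intro g g' hg
      dsimp only at hg
      apply yonedaEquiv.injective
      refine (h _ (sieveFamily_compatible F U (sieveMap U ≫ g))).unique (fun i => ?_) fun i => ?_
      · rw [sieveFamily_comp]
      · rw [hg, sieveFamily_comp]
    · intro f
      obtain ⟨t, ht, -⟩ := h _ (sieveFamily_compatible F U f)
      refine ⟨yonedaEquiv.symm t, sieve_hom_ext F U ?_⟩
      funext i
      rw [sieveFamily_comp, Equiv.apply_symm_apply, ht]

variable (Q) in
/-- A small family of morphisms whose local objects are the sheaves. Families indexed by subsets
of `Q × Bool` suffice, because a compatible family on a sheaf takes equal values at indices with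
equal members of the cover. -/
abbrev coverings : MorphismProperty (Qᵒᵖ ⥤ Type u) :=
  MorphismProperty.ofHoms fun T : Set (Q × Bool) => sieveMap fun i : T => i.1.1

variable (Q) in
lemma isLocal_coverings : (coverings Q).isLocal = IsSheaf Q := by
  ext F
  constructor
  · intro hF
    have key (T : Set (Q × Bool)) := (bijective_sieveMap_iff F fun i : T => i.1.1).1
      (hF _ (MorphismProperty.ofHoms.mk T))
    have inj {v : Q} {x y : F.obj (op v)}
        (h : res F (IsSemicartesian.mul_le_fst v v) x =
          res F (IsSemicartesian.mul_le_fst v v) y) : x = y := by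
      let T : Set (Q × Bool) := {p | p.1 = v}
      have hT (i : T) : i.1.1 = v := i.2
      have hs (i : T) : i.1.1 ≤ v := (hT i).le
      obtain ⟨t, ht, -⟩ := key T (fun i => res F (hs i) (if i.1.2 then x else y)) (by
        rintro ⟨⟨w, b⟩, hw⟩ ⟨⟨w', b'⟩, hw'⟩
        obtain rfl : w = v := hw
        obtain rfl : w' = w := hw'
        simp only [res_self]
        cases b <;> cases b' <;> simp [h])
      have h1 := ht ⟨(v, true), rfl⟩
      have h2 := ht ⟨(v, false), rfl⟩
      simp only [res_self] at h1 h2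
      simpa using h1.symm.trans h2
    intro I U s hs
    have eqv (i j : I) (w : Q) (hi : w = U i) (hj : w = U j) :
        res F hi.le (s i) = res F hj.le (s j) := by
      apply inj
      rw [res_res, res_res]
      have := congrArg (res F (show w * w ≤ U i * U j by rw [← hi, ← hj])) (hs i j)
      rwa [res_res, res_res] at this
    let T : Set (Q × Bool) := {p | p.2 = true ∧ ∃ i, p.1 = U i}
    choose f hf using fun i : T => i.2.2
    have hsup : ⨆ i : T, i.1.1 = ⨆ i, U i := by
      apply le_antisymm
      · exact iSup_le fun i => (hf i).le.trans (le_iSup U _)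
      · exact iSup_le fun i => le_iSup (fun i : T => i.1.1) ⟨(U i, true), rfl, i, rfl⟩
    obtain ⟨t, ht, huniq⟩ := key T (fun i => res F (hf i).le (s (f i))) (by
      intro i j
      have := congrArg (res F (show i.1.1 * j.1.1 ≤ U (f i) * U (f j) by
        rw [← hf i, ← hf j])) (hs (f i) (f j))
      rw [res_res, res_res] at this ⊢
      exact this)
    refine ⟨res F hsup.ge t, fun i => ?_, fun t' ht' => ?_⟩
    · have h1 := ht ⟨(U i, true), rfl, i, rfl⟩
      have h2 := eqv (f ⟨(U i, true), rfl, i, rfl⟩) i (U i) (hf ⟨(U i, true), rfl, i, rfl⟩) rfl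
      rw [res_self F le_rfl] at h2
      rw [res_res]
      exact h1.trans h2
    · have h1 := huniq (res F hsup.le t') fun i => by
        rw [res_res, ← ht' (f i), res_res]
      rw [← h1, res_res, res_self]
  · rintro hF _ _ _ ⟨T⟩
    exact (bijective_sieveMap_iff F _).2 (hF T _)

variable (Q) in
lemma isRightAdjoint_ι : (IsSheaf Q).ι.IsRightAdjoint := by
  rw [← isLocal_coverings Q]
  choose κ hκ hκ' using fun X : (Set (Q × Bool) × Bool) =>
    Functor.IsAccessible.exists_cardinal.{u} (F := coyoneda.obj (op
      (if X.2 then sieve (fun i : X.1 => i.1.1) else yoneda.obj (⨆ i : X.1, i.1.1))))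
  let κ' : Cardinal.{u} := Order.succ (max Cardinal.aleph0 (⨆ X, κ X))
  have : Fact κ'.IsRegular := ⟨Cardinal.isRegular_succ (le_max_left _ _)⟩
  have hle (X) : κ X ≤ κ' :=
    (le_ciSup (Cardinal.bddAbove_of_small) X).trans ((le_max_right _ _).trans (Order.le_succ _))
  refine MorphismProperty.isRightAdjoint_ι_isLocal (coverings Q) κ' ?_
  rintro _ _ _ ⟨T⟩
  have h₁ : (coyoneda.obj (op (sieve fun i : T => i.1.1))).IsCardinalAccessible (κ (T, true)) :=
    hκ' (T, true)
  have h₂ : (coyoneda.obj (op (yoneda.obj (⨆ i : T, i.1.1)))).IsCardinalAccessible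
    (κ (T, false)) := hκ' (T, false)
  exact ⟨Functor.isCardinalAccessible_of_le _ (hle (T, true)),
    Functor.isCardinalAccessible_of_le _ (hle (T, false))⟩

noncomputable instance : Reflective (IsSheaf Q).ι where
  L := @Functor.leftAdjoint _ _ _ _ (IsSheaf Q).ι (isRightAdjoint_ι Q)
  adj := @Adjunction.ofIsRightAdjoint _ _ _ _ (IsSheaf Q).ι (isRightAdjoint_ι Q)

variable (Q) in
/-- The sheafification functor, left adjoint to the inclusion of sheaves into presheaves. -/
noncomputable abbrev sheafification : (Qᵒᵖ ⥤ Type u) ⥤ Sh Q := reflector (IsSheaf Q).ι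

instance : HasLimitsOfSize.{u, u} (Sh Q) := hasLimits_of_reflective (IsSheaf Q).ι

instance : HasFiniteLimits (Sh Q) := hasFiniteLimits_of_hasLimitsOfSize (Sh Q)

lemma exists_repr_hom (F : Sh Q) (a : Q) (x : F.obj.obj (op a)) :
    ∃ f : reprSheaf a ⟶ F, yonedaEquiv f.hom = x :=
  ⟨ObjectProperty.homMk (yonedaEquiv.symm x), yonedaEquiv.apply_symm_apply x⟩

instance : WellPowered.{u} (Sh Q) := by
  refine wellPowered_of_isDetecting (𝒢 := ObjectProperty.ofObj (reprSheaf (Q := Q))) ?_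
  intro F G f hf
  have (a : Q) : Function.Bijective (f.hom.app (op a)) := by
    have comp (g : reprSheaf a ⟶ F) : yonedaEquiv (g ≫ f).hom = f.hom.app (op a) (yonedaEquiv g.hom) :=
      yonedaEquiv_comp _ _
    constructor
    · intro x y hxy
      obtain ⟨g, rfl⟩ := exists_repr_hom F a x
      obtain ⟨g', rfl⟩ := exists_repr_hom F a y
      obtain ⟨k, -, hk⟩ := hf _ (ObjectProperty.ofObj_apply _ a) (g ≫ f)
      have : g' ≫ f = g ≫ f := by
        ext1
        apply yonedaEquiv.injective
        rw [comp, comp, hxy]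
      rw [hk g rfl, hk g' this]
    · intro y
      obtain ⟨g, rfl⟩ := exists_repr_hom G a y
      obtain ⟨k, hk, -⟩ := hf _ (ObjectProperty.ofObj_apply _ a) g
      exact ⟨yonedaEquiv k.hom, by rw [← comp, hk]⟩
  have : IsIso ((IsSheaf Q).ι.map f) := by
    change IsIso f.hom
    rw [NatTrans.isIso_iff_isIso_app]
    exact fun a => (isIso_iff_bijective _).2 (this (unop a))
  exact isIso_of_fully_faithful (IsSheaf Q).ι f

end Sheafification

/-! ### The tensor product and the operation on subobjects -/

section Tensor

variable {Q : Type u} [CommSemigroup Q] [CompleteLattice Q] [IsQuantale Q] [IsSemicartesian Q]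

variable (Q) in
/-- The multiplication of `Q` as a functor. -/
def mulFunctor : Qᵒᵖ × Qᵒᵖ ⥤ Qᵒᵖ where
  obj p := op (unop p.1 * unop p.2)
  map f := (homOfLE (mul_le_mul' (leOfHom f.1.unop) (leOfHom f.2.unop))).op

/-- The Day convolution of two presheaves: the left Kan extension of the external product
`(u, v) ↦ F u × G v` along the multiplication of `Q`. -/
noncomputable def day (F G : Qᵒᵖ ⥤ Type u) : Qᵒᵖ ⥤ Type u :=
  (mulFunctor Q).leftKanExtension (F ⊠ G)

/-- The projection of the Day convolution to the first factor, given on `F u × G v` by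
`(x, y) ↦ x` restricted to `u * v`. -/
noncomputable def dayFst (F G : Qᵒᵖ ⥤ Type u) : day F G ⟶ F :=
  Functor.descOfIsLeftKanExtension _ ((mulFunctor Q).leftKanExtensionUnit (F ⊠ G)) F
    { app := fun p => ↾fun x : F.obj p.1 × G.obj p.2 =>
        res F (IsSemicartesian.mul_le_fst (unop p.1) (unop p.2)) x.1
      naturality := fun p q f => by
        ext x
        exact (res_res F _ _ _).trans (res_res F _ _ _).symm }

/-- The projection of the Day convolution to the second factor, given on `F u × G v` by
`(x, y) ↦ y` restricted to `u * v`. -/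
noncomputable def daySnd (F G : Qᵒᵖ ⥤ Type u) : day F G ⟶ G :=
  Functor.descOfIsLeftKanExtension _ ((mulFunctor Q).leftKanExtensionUnit (F ⊠ G)) G
    { app := fun p => ↾fun x : F.obj p.1 × G.obj p.2 =>
        res G (IsSemicartesian.mul_le_snd (unop p.1) (unop p.2)) x.2
      naturality := fun p q f => by
        ext x
        exact (res_res G _ _ _).trans (res_res G _ _ _).symm }

/-- The tensor product of sheaves: the sheafification of the Day convolution. -/
noncomputable def tensor (F G : Sh Q) : Sh Q := (sheafification Q).obj (day F.obj G.obj)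

/-- The projection `F ⊗ G ⟶ F`. -/
noncomputable def tensorFst (F G : Sh Q) : tensor F G ⟶ F :=
  ((reflectorAdjunction (IsSheaf Q).ι).homEquiv _ _).symm (dayFst F.obj G.obj)

/-- The projection `F ⊗ G ⟶ G`. -/
noncomputable def tensorSnd (F G : Sh Q) : tensor F G ⟶ G :=
  ((reflectorAdjunction (IsSheaf Q).ι).homEquiv _ _).symm (daySnd F.obj G.obj)

/-- The mono part of the extremal factorization of a morphism: the least subobject of the target
through which the morphism factors. -/
noncomputable def extremalImage {G F : Sh Q} (f : G ⟶ F) : Subobject F :=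
  sInf {S : Subobject F | S.Factors f}

lemma isLeast_extremalImage {G F : Sh Q} (f : G ⟶ F) :
    IsLeast {S : Subobject F | S.Factors f} (extremalImage f) := by
  refine ⟨?_, fun S hS => sInf_le hS⟩
  have fac (j : equivShrink (Subobject F) '' {S : Subobject F | S.Factors f}) :
      ((equivShrink (Subobject F)).symm j).Factors f := by
    obtain ⟨_, S, hS, rfl⟩ := j
    simpa using hS
  let c : Cone (Subobject.wideCospan {S : Subobject F | S.Factors f}) :=
    WidePullbackShape.mkCone f (fun j => Subobject.factorThru _ f (fac j))
      fun j => Subobject.factorThru_arrow _ f (fac j)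
  exact (Subobject.mk_factors_iff _ _).2 ⟨limit.lift _ c, limit.lift_π c none⟩

/-- The morphism `F₀ ⊗_F F₁ ⟶ F₀ ⊗ F₁ ⇉ F`, where `F₀ ⊗_F F₁` is the equalizer of the two
composites `F₀ ⊗ F₁ ⟶ Fᵢ ⟶ F`. -/
noncomputable def subMulHom {F F₀ F₁ : Sh Q} (φ₀ : F₀ ⟶ F) (φ₁ : F₁ ⟶ F) :
    equalizer (tensorFst F₀ F₁ ≫ φ₀) (tensorSnd F₀ F₁ ≫ φ₁) ⟶ F :=
  equalizer.ι (tensorFst F₀ F₁ ≫ φ₀) (tensorSnd F₀ F₁ ≫ φ₁) ≫ tensorFst F₀ F₁ ≫ φ₀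

/-- The operation `*` on the subobjects of a sheaf. -/
noncomputable def subMul {F : Sh Q} (A B : Subobject F) : Subobject F :=
  extremalImage (subMulHom A.arrow B.arrow)

/-- The multiplication of `Q` on the interval `[0, a]`. -/
def iicMul {a : Q} (q r : Set.Iic a) : Set.Iic a :=
  ⟨q.1 * r.1, (IsSemicartesian.mul_le_fst q.1 r.1).trans q.2⟩

/-- The map `k_a : [0, a] → Sub (Q(-, a))` sending `q` to the class of `Q(-, q) ⟶ Q(-, a)`. -/
noncomputable def kMap (a : Q) (q : Set.Iic a) : Subobject (reprSheaf a) :=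
  Subobject.mk (reprMap q.2)

/-- The map `Q → Sub 1` sending `q` to the class of the unique morphism `Q(-, q) ⟶ 1`. -/
noncomputable def kOne (q : Q) : Subobject (⊤_ (Sh Q)) :=
  Subobject.mk (terminal.from (reprSheaf q))

end Tensor

end QuantaleSheaf

/-! ### Transport of quantale structures -/

/-! Everything is measured by `support`. A subterminal sheaf has at most one section over each `v`,
and it has one exactly when `v` lies below its support, because arbitrary choices of sections are
compatible and glue. Hence a morphism into a subterminal sheaf exists as soon as the supports are in
order. Subobjects of `Q(-, a)` or of the terminal sheaf are therefore classified by their supports,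
and each `q` below the support of the ambient sheaf is realised by `Q(-, q)`.

The operation `*` becomes multiplication of supports: the tensor product multiplies supports
(`support_tensor`), the equalizer is trivial over a subterminal sheaf, and the extremal image keeps
the support (`support_subMul`). So `k_a` and `kOne` are isomorphisms, along which the quantale
axioms are transported.

For the negative statement, a topos is balanced, while `Q(-, v * v) ⟶ Q(-, v)` is always mono and
epi. In a topos every `v` is thus idempotent, which forces the multiplication to be the meet. -/

lemma IsQuantaleIso.isCommSemicartesianQuantale {P R : Type*} [PartialOrder P] [PartialOrder R]
    {m : P → P → P} {n : R → R → R} {f : P → R} (hf : IsQuantaleIso m n f)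
    (hm : IsCommSemicartesianQuantale m) : IsCommSemicartesianQuantale n := by
  let e : P ≃o R := ⟨Equiv.ofBijective f hf.bijective, fun {x y} => hf.le_iff_le x y⟩
  have map_mul (x y : P) : e (m x y) = n (e x) (e y) := hf.map_mul x y
  have lub (S : Set R) (r : R) : IsLUB (e ⁻¹' S) (e.symm r) ↔ IsLUB S r := by
    rw [e.isLUB_preimage, e.apply_symm_apply]
  refine ⟨fun S => ?_, fun S => ?_, fun x y z => ?_, fun x S s hs => ?_, fun x S s hs => ?_,
    fun x y => ?_, fun x y => ?_, fun x y => ?_⟩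
  · obtain ⟨p, hp⟩ := hm.exists_isLUB (e ⁻¹' S)
    exact ⟨e p, e.isLUB_preimage.1 hp⟩
  · obtain ⟨p, hp⟩ := hm.exists_isGLB (e ⁻¹' S)
    exact ⟨e p, e.isGLB_preimage.1 hp⟩
  · obtain ⟨x, rfl⟩ := e.surjective x
    obtain ⟨y, rfl⟩ := e.surjective y
    obtain ⟨z, rfl⟩ := e.surjective z
    simp only [← map_mul, hm.assoc]
  · have h := hm.mul_isLUB (e.symm x) _ _ ((lub S s).2 hs)
    rw [← e.isLUB_image'] at h
    convert h using 1
    · ext r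
      constructor
      · rintro ⟨t, ht, rfl⟩
        exact ⟨_, ⟨e.symm t, by simpa using ht, rfl⟩, by simp [map_mul]⟩
      · rintro ⟨_, ⟨t, ht, rfl⟩, rfl⟩
        exact ⟨e t, ht, by simp [map_mul]⟩
    · simp [map_mul]
  · have h := hm.isLUB_mul (e.symm x) _ _ ((lub S s).2 hs)
    rw [← e.isLUB_image'] at h
    convert h using 1
    · ext r
      constructor
      · rintro ⟨t, ht, rfl⟩
        exact ⟨_, ⟨e.symm t, by simpa using ht, rfl⟩, by simp [map_mul]⟩
      · rintro ⟨_, ⟨t, ht, rfl⟩, rfl⟩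
        exact ⟨e t, ht, by simp [map_mul]⟩
    · simp [map_mul]
  · obtain ⟨x, rfl⟩ := e.surjective x
    obtain ⟨y, rfl⟩ := e.surjective y
    rw [← map_mul, ← map_mul, hm.comm]
  · obtain ⟨x, rfl⟩ := e.surjective x
    obtain ⟨y, rfl⟩ := e.surjective y
    rw [← map_mul, e.le_iff_le]
    exact hm.le_fst x y
  · obtain ⟨x, rfl⟩ := e.surjective x
    obtain ⟨y, rfl⟩ := e.surjective y
    rw [← map_mul, e.le_iff_le]
    exact hm.le_snd x y

namespace QuantaleSheaf

/-! ### Intervals of a quantale and idempotent multiplication -/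

section Quantale

variable {Q : Type u} [CommSemigroup Q] [CompleteLattice Q] [IsQuantale Q] [IsSemicartesian Q]

lemma isCommSemicartesianQuantale_iicMul (a : Q) :
    IsCommSemicartesianQuantale (iicMul (a := a)) := by
  have comm (x y : Set.Iic a) : iicMul x y = iicMul y x := Subtype.ext (mul_comm x.1 y.1)
  have lub (x : Set.Iic a) (S : Set (Set.Iic a)) (s : Set.Iic a) (hs : IsLUB S s) :
      IsLUB (iicMul x '' S) (iicMul x s) := by
    constructor
    · rintro _ ⟨t, ht, rfl⟩
      exact mul_le_mul_right (α := Q) (hs.1 ht) x.1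
    · intro b hb
      -- The join taken in `Q` stays below `a`, so it is an upper bound inside the interval and
      -- dominates `s`; distributivity in `Q` then applies.
      have h : s.1 ≤ sSup (Subtype.val '' S) :=
        hs.2 (show (⟨sSup (Subtype.val '' S), sSup_le (by rintro _ ⟨t, -, rfl⟩; exact t.2)⟩ :
          Set.Iic a) ∈ upperBounds S from fun t ht => le_sSup (α := Q) ⟨t, ht, rfl⟩)
      refine (mul_le_mul_right h x.1).trans ?_
      rw [IsQuantale.mul_sSup_distrib]
      refine iSup₂_le ?_
      rintro _ ⟨t, ht, rfl⟩
      exact hb ⟨t, ht, rfl⟩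
  exact
    { exists_isLUB := fun S => ⟨sSup S, isLUB_sSup S⟩
      exists_isGLB := fun S => ⟨sInf S, isGLB_sInf S⟩
      assoc := fun x y z => Subtype.ext (mul_assoc x.1 y.1 z.1)
      mul_isLUB := lub
      isLUB_mul := fun x S s hs => by
        simpa only [comm _ x] using lub x S s hs
      comm := comm
      le_fst := fun x y => IsSemicartesian.mul_le_fst x.1 y.1
      le_snd := fun x y => IsSemicartesian.mul_le_snd x.1 y.1 }

lemma isQuantaleIso_coe_iic_top :
    IsQuantaleIso (iicMul (a := (⊤ : Q))) (fun q r : Q => q * r) Subtype.val where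
  bijective := ⟨Subtype.val_injective, fun q => ⟨⟨q, le_top⟩, rfl⟩⟩
  le_iff_le _ _ := Iff.rfl
  map_mul _ _ := rfl

lemma mul_eq_inf_of_mul_self (h : ∀ x : Q, x * x = x) (x y : Q) : x * y = x ⊓ y :=
  le_antisymm (le_inf (IsSemicartesian.mul_le_fst x y) (IsSemicartesian.mul_le_snd x y))
    ((h (x ⊓ y)).symm.le.trans (mul_le_mul' inf_le_left inf_le_right))

end Quantale

/-! ### The support of a sheaf -/

section Support

variable {Q : Type u} [CommSemigroup Q] [CompleteLattice Q] [IsSemicartesian Q]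

/-- The join of all `v` on which the sheaf has a section. -/
def support (F : Sh Q) : Q := sSup {v | Nonempty (F.obj.obj (op v))}

lemma subsingleton_obj {F : Sh Q} (hF : IsSubterminal F) (v : Q) :
    Subsingleton (F.obj.obj (op v)) where
  allEq x y := by
    obtain ⟨f, rfl⟩ := exists_repr_hom F v x
    obtain ⟨g, rfl⟩ := exists_repr_hom F v y
    rw [hF f g]

lemma isSubterminal_reprSheaf (a : Q) : IsSubterminal (reprSheaf a) := fun _ f g => by
  ext v x
  exact Subsingleton.elim (α := (yoneda.obj a).obj v) _ _

lemma isSubterminal_of_mono {F G : Sh Q} (hG : IsSubterminal G) (f : F ⟶ G) [Mono f] :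
    IsSubterminal F := fun _ g h => by
  rw [← cancel_mono f]
  exact hG _ _

/-- Uniqueness of sections makes any choice over the members of `T` compatible. The glued section
lives over the support and restricts to everything below it. -/
lemma nonempty_obj_iff_le_support {F : Sh Q} (hF : IsSubterminal F) {v : Q} :
    Nonempty (F.obj.obj (op v)) ↔ v ≤ support F := by
  refine ⟨fun h => le_sSup h, fun hv => ?_⟩
  let T : Set Q := {v | Nonempty (F.obj.obj (op v))}
  obtain ⟨t, -, -⟩ := F.property T (fun i => i.1) (fun i => i.2.some)
    fun i j => (subsingleton_obj hF _).elim _ _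
  exact ⟨res F.obj (by simpa [T, support, sSup_eq_iSup'] using hv) t⟩

/-- A natural transformation into a presheaf of subsingletons only has to be defined pointwise. -/
lemma nonempty_hom_of_subsingleton {C : Type*} [Category C] {F G : C ⥤ Type u}
    (hG : ∀ c, Subsingleton (G.obj c)) (h : ∀ c, F.obj c → Nonempty (G.obj c)) :
    Nonempty (F ⟶ G) :=
  ⟨{ app := fun c => ↾fun x => (h c x).some
     naturality := fun _ d _ => by
      ext x
      exact (hG d).elim _ _ }⟩

lemma nonempty_hom_iff_support_le {F G : Sh Q} (hG : IsSubterminal G) :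
    Nonempty (F ⟶ G) ↔ support F ≤ support G := by
  constructor
  · rintro ⟨f⟩
    exact sSup_le fun v ⟨x⟩ => le_sSup ⟨f.hom.app (op v) x⟩
  · intro h
    obtain ⟨f⟩ := nonempty_hom_of_subsingleton (F := F.obj) (G := G.obj)
      (fun c => subsingleton_obj hG c.unop)
      fun c x => (nonempty_obj_iff_le_support hG).2 ((le_sSup ⟨x⟩ : c.unop ≤ support F).trans h)
    exact ⟨ObjectProperty.homMk f⟩

lemma support_reprSheaf (a : Q) : support (reprSheaf a) = a :=
  le_antisymm (sSup_le fun _ ⟨f⟩ => leOfHom f) (le_sSup ⟨𝟙 a⟩)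

lemma support_eq_of_iso {F G : Sh Q} (e : F ≅ G) : support F = support G := by
  refine le_antisymm (sSup_le fun v ⟨x⟩ => le_sSup ⟨e.hom.hom.app (op v) x⟩)
    (sSup_le fun v ⟨x⟩ => le_sSup ⟨e.inv.hom.app (op v) x⟩)

lemma support_terminal : support (⊤_ (Sh Q)) = ⊤ :=
  top_le_iff.1 <| (support_reprSheaf (⊤ : Q)).symm.le.trans <|
    (nonempty_hom_iff_support_le fun _ _ _ => terminal.hom_ext _ _).1 ⟨terminal.from _⟩

lemma support_mk_reprSheaf {F : Sh Q} {q : Q} (f : reprSheaf q ⟶ F) :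
    support (Subobject.mk f : Sh Q) = q :=
  (support_eq_of_iso (Subobject.underlyingIso f)).trans (support_reprSheaf q)

variable {F : Sh Q}

lemma subobject_le_iff_support_le (hF : IsSubterminal F) {A B : Subobject F} :
    A ≤ B ↔ support (A : Sh Q) ≤ support (B : Sh Q) := by
  rw [← nonempty_hom_iff_support_le (isSubterminal_of_mono hF B.arrow)]
  exact ⟨fun h => ⟨Subobject.ofLE A B h⟩, fun ⟨f⟩ => Subobject.le_of_comm f (hF _ _)⟩

lemma subobject_ext_support (hF : IsSubterminal F) {A B : Subobject F}
    (h : support (A : Sh Q) = support (B : Sh Q)) :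
    A = B :=
  le_antisymm ((subobject_le_iff_support_le hF).2 h.le) ((subobject_le_iff_support_le hF).2 h.ge)

lemma factors_iff_support_le (hF : IsSubterminal F) {G : Sh Q} (f : G ⟶ F) (A : Subobject F) :
    A.Factors f ↔ support G ≤ support (A : Sh Q) := by
  rw [← nonempty_hom_iff_support_le (isSubterminal_of_mono hF A.arrow)]
  exact ⟨fun h => ⟨A.factorThru f h⟩, fun ⟨g⟩ => (Subobject.factors_iff A f).2 ⟨g, hF _ _⟩⟩

lemma exists_support_eq (hF : IsSubterminal F) {q : Q} (hq : q ≤ support F) :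
    ∃ f : reprSheaf q ⟶ F, support (Subobject.mk f : Sh Q) = q := by
  obtain ⟨f⟩ := (nonempty_hom_iff_support_le (F := reprSheaf q) hF).2
    (by rwa [support_reprSheaf])
  exact ⟨f, support_mk_reprSheaf f⟩

end Support

/-! ### Supports of tensor products and of `*` -/

section Product

variable {Q : Type u} [CommSemigroup Q] [CompleteLattice Q] [IsQuantale Q] [IsSemicartesian Q]

/-- By the two universal properties, a morphism out of the tensor product is a natural family `F u ×
G v → H (u * v)`. Naturality is automatic for subterminal `H`, so only nonemptiness of the targets
matters; distributivity over joins collects these conditions into one inequality. -/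
lemma nonempty_tensor_hom_iff {F G H : Sh Q} (hH : IsSubterminal H) :
    Nonempty (tensor F G ⟶ H) ↔ support F * support G ≤ support H := by
  have e := ((reflectorAdjunction (IsSheaf Q).ι).homEquiv (day F.obj G.obj) H).trans
    (Functor.homEquivOfIsLeftKanExtension _
      ((mulFunctor Q).leftKanExtensionUnit (F.obj ⊠ G.obj)) H.obj)
  refine e.nonempty_congr.trans ⟨fun ⟨f⟩ => ?_, fun h => ?_⟩
  · rw [support, support, IsQuantale.sSup_mul_distrib]
    refine iSup₂_le fun v ⟨x⟩ => ?_
    rw [IsQuantale.mul_sSup_distrib]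
    exact iSup₂_le fun w ⟨y⟩ => le_sSup ⟨f.app (op v, op w) (x, y)⟩
  · refine nonempty_hom_of_subsingleton (fun p => subsingleton_obj hH _) fun p x => ?_
    refine (nonempty_obj_iff_le_support hH).2 (le_trans ?_ h)
    exact mul_le_mul' (le_sSup ⟨x.1⟩) (le_sSup ⟨x.2⟩)

lemma support_tensor_le_iff {F G H : Sh Q} (hH : IsSubterminal H) :
    support (tensor F G) ≤ support H ↔ support F * support G ≤ support H := by
  rw [← nonempty_hom_iff_support_le hH, nonempty_tensor_hom_iff hH]

/-- An element of `Q` is determined by its upper bounds, and each `q` can be tested through the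
subterminal sheaf `Q(-, q)`. -/
lemma support_tensor (F G : Sh Q) : support (tensor F G) = support F * support G := by
  refine eq_of_forall_ge_iff fun q => ?_
  have := support_tensor_le_iff (F := F) (G := G) (isSubterminal_reprSheaf q)
  rwa [support_reprSheaf] at this

variable {F : Sh Q}

lemma support_extremalImage (hF : IsSubterminal F) {G : Sh Q} (f : G ⟶ F) :
    support (extremalImage f : Sh Q) = support G := by
  have h := isLeast_extremalImage f
  refine le_antisymm ?_ ((factors_iff_support_le hF f _).1 h.1)
  -- The copy of `Q(-, support G)` inside `F` is a subobject through which `f` factors, so the least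
  -- such subobject lies below it.
  obtain ⟨g, hg⟩ := exists_support_eq hF ((nonempty_hom_iff_support_le hF).1 ⟨f⟩)
  refine ((subobject_le_iff_support_le hF).1 (h.2 ?_)).trans hg.le
  exact (factors_iff_support_le hF f _).2 hg.ge

lemma support_subMul (hF : IsSubterminal F) (A B : Subobject F) :
    support (subMul A B : Sh Q) = support (A : Sh Q) * support (B : Sh Q) := by
  have h : tensorFst (A : Sh Q) (B : Sh Q) ≫ A.arrow = tensorSnd (A : Sh Q) (B : Sh Q) ≫ B.arrow :=
    hF _ _
  -- The two composites into the subterminal `F` coincide, so their equalizer is the whole tensor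
  -- product.
  have := equalizer.ι_of_eq h
  rw [subMul, support_extremalImage hF, ← support_tensor]
  exact support_eq_of_iso (asIso (equalizer.ι _ _))

/-- Common source of the results for `kMap` and `kOne`: `i` identifies `P` with the elements of `Q`
below `support F`. -/
lemma isQuantaleIso_mk (hF : IsSubterminal F) {P : Type*} [PartialOrder P] (m : P → P → P)
    (i : P → Q)
    (hi : ∀ x y, i x ≤ i y ↔ x ≤ y) (hm : ∀ x y, i (m x y) = i x * i y)
    (hr : ∀ q ≤ support F, ∃ x, i x = q) (k : ∀ x, reprSheaf (i x) ⟶ F) :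
    IsQuantaleIso m (subMul (F := F)) fun x => Subobject.mk (k x) := by
  have le (x y : P) : Subobject.mk (k x) ≤ Subobject.mk (k y) ↔ x ≤ y := by
    rw [subobject_le_iff_support_le hF, support_mk_reprSheaf, support_mk_reprSheaf, hi]
  refine ⟨⟨fun x y h => ?_, fun A => ?_⟩, le, fun x y => subobject_ext_support hF ?_⟩
  · exact le_antisymm ((le x y).1 h.le) ((le y x).1 h.ge)
  · obtain ⟨x, hx⟩ := hr (support (A : Sh Q)) ((nonempty_hom_iff_support_le hF).1 ⟨A.arrow⟩)
    exact ⟨x, subobject_ext_support hF ((support_mk_reprSheaf _).trans hx)⟩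
  · rw [support_subMul hF, support_mk_reprSheaf, support_mk_reprSheaf, support_mk_reprSheaf, hm]

lemma isQuantaleIso_kMap (a : Q) :
    IsQuantaleIso (iicMul (a := a)) (subMul (F := reprSheaf a)) (kMap a) :=
  isQuantaleIso_mk (isSubterminal_reprSheaf a) _ Subtype.val (fun _ _ => Iff.rfl)
    (fun _ _ => rfl) (fun q hq => ⟨⟨q, hq.trans (support_reprSheaf a).le⟩, rfl⟩)
    fun q => reprMap q.2

lemma isQuantaleIso_kOne :
    IsQuantaleIso (fun q r : Q => q * r) (subMul (F := ⊤_ (Sh Q))) kOne :=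
  isQuantaleIso_mk (fun _ _ _ => terminal.hom_ext _ _) _ id (fun _ _ => Iff.rfl)
    (fun _ _ => rfl) (fun q _ => ⟨q, rfl⟩) fun q => terminal.from (reprSheaf q)

end Product

/-! ### Failure of balance -/

section Balanced

variable {Q : Type u} [CommSemigroup Q] [CompleteLattice Q] [IsSemicartesian Q]

/-- Sections of a sheaf over `v` are determined by their restriction to `v * v`. -/
lemma res_mul_self_injective (F : Sh Q) (v : Q) :
    Function.Injective (res F.obj (IsSemicartesian.mul_le_fst v v)) := by
  intro x y h
  obtain ⟨t, ht, -⟩ := F.property (ULift Bool) (fun _ => v) (fun i => if i.down then x else y) (by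
    rintro ⟨i⟩ ⟨j⟩
    cases i <;> cases j <;> simp [h])
  have h₁ := ht ⟨true⟩
  have h₂ := ht ⟨false⟩
  simpa using h₁.symm.trans h₂

lemma epi_reprMap_mul_self (v : Q) : Epi (reprMap (IsSemicartesian.mul_le_fst v v)) where
  left_cancellation {F} g h w := by
    ext1
    apply yonedaEquiv.injective
    apply res_mul_self_injective F v
    have key (f : reprSheaf v ⟶ F) : res F.obj (IsSemicartesian.mul_le_fst v v)
        (yonedaEquiv f.hom) =
          yonedaEquiv (reprMap (IsSemicartesian.mul_le_fst v v) ≫ f).hom :=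
      yonedaEquiv_naturality f.hom _
    rw [key, key, w]

/-- In a balanced category of sheaves every `v` is idempotent, because `Q(-, v * v) ⟶ Q(-, v)` is
both mono and epi. -/
lemma mul_self_of_balanced [Balanced (Sh Q)] (v : Q) : v * v = v := by
  have := epi_reprMap_mul_self v
  have := isIso_of_mono_of_epi (reprMap (IsSemicartesian.mul_le_fst v v))
  have h := support_eq_of_iso (asIso (reprMap (IsSemicartesian.mul_le_fst v v)))
  rwa [support_reprSheaf, support_reprSheaf] at h

end Balanced

lemma mul_eq_inf_of_isElementaryTopos {Q : Type u} [CommSemigroup Q] [CompleteLattice Q]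
    [IsQuantale Q] [IsSemicartesian Q] (h : IsElementaryTopos (Sh Q)) (x y : Q) :
    x * y = x ⊓ y := by
  obtain ⟨_, _, _, _⟩ := h
  -- A subobject classifier makes every mono regular, hence strong, and a strong mono that is epi is
  -- an isomorphism.
  have : Balanced (Sh Q) := balanced_of_strongMonoCategory
  exact mul_eq_inf_of_mul_self mul_self_of_balanced x y

end QuantaleSheaf

open CategoryTheory CategoryTheory.Limits QuantaleSheaf

theorem mainTheorem2 {Q : Type u} [CommSemigroup Q] [CompleteLattice Q] [IsQuantale Q]
    [IsSemicartesian Q] :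
    (∀ a : Q,
      IsCommSemicartesianQuantale (subMul (F := reprSheaf a)) ∧
      IsCommSemicartesianQuantale (iicMul (a := a)) ∧
      IsQuantaleIso (iicMul (a := a)) (subMul (F := reprSheaf a)) (kMap a)) ∧
    IsCommSemicartesianQuantale (subMul (F := ⊤_ (Sh Q))) ∧
    IsQuantaleIso (fun q r : Q => q * r) (subMul (F := ⊤_ (Sh Q))) kOne ∧
    ((¬ ∀ x y : Q, x * y = x ⊓ y) → ¬ IsElementaryTopos (Sh Q)) ∧
    ((¬ ∀ (x : Q) (S : Set Q), x ⊓ sSup S = ⨆ y ∈ S, x ⊓ y) → ¬ IsElementaryTopos (Sh Q)) := by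
  refine ⟨fun a => ⟨?_, isCommSemicartesianQuantale_iicMul a, isQuantaleIso_kMap a⟩, ?_,
    isQuantaleIso_kOne, fun h hT => h (mul_eq_inf_of_isElementaryTopos hT),
    fun h hT => h fun x S => ?_⟩
  · exact (isQuantaleIso_kMap a).isCommSemicartesianQuantale (isCommSemicartesianQuantale_iicMul a)
  -- The axioms pass from `[0, ⊤]` to `Q`, and from there to the subobjects of the terminal sheaf.
  · exact isQuantaleIso_kOne.isCommSemicartesianQuantale <|
      isQuantaleIso_coe_iic_top.isCommSemicartesianQuantale <|
        isCommSemicartesianQuantale_iicMul (⊤ : Q)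
  -- In a topos the meet is the multiplication, so it inherits distributivity over joins.
  · simp only [← mul_eq_inf_of_isElementaryTopos hT, IsQuantale.mul_sSup_distrib]
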